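/- Let $K$ be a field. An ideal of a polynomial ring $K[x_1,\dots,x_n]$ is called toric if it is the kernel of a $K$-algebra morphism $K[x_1,\dots,x_n]\to K[t_1^{\pm1},\dots,t_m^{\pm1}]$ (for some $m\ge 0$) sending each variable $x_i$ to a Laurent monomial $Y_i={\bf t}^{\alpha_i}$, $\alpha_i\in\mathbb Z^m$. It is called minimally parametrized if, in addition, the morphism can be chosen so that $Y_1,\dots,Y_n$ form a minimal system of algebra generators, i.e. no $Y_i$ lies in $K[Y_j : j\ne i]$. Homogeneous means homogeneous for the standard grading. Theorem. Let ${\bf x}_1,\dots,{\bf x}_k$ be finite sets of variables with $|{\bf x}_i\cap{\bf x}_j|\le 1$ for all $i\ne j$, let ${\bf x}=\bigcup_{i=1}^k{\bf x}_i$, and let $I_1\subset K[{\bf x}_1],\dots,I_k\subset K[{\bf x}_k]$ be homogeneous toric ideals. Let $G=G(I_1,\dots,I_k)$ be the graph with vertices $1,\dots,k$ (one for each $I_i$) in which $i\neq j$ are joined by an edge if and only if ${\bf x}_i\cap{\bf x}_j\neq\emptyset$. Suppose that every connected component of $G$ is a tree, and let $r$ be the number of connected components. Let $J=\sum_{i=1}^k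 I_iK[{\bf x}]$. Then $J$ is a homogeneous toric ideal of $K[{\bf x}]$; if moreover all the $I_i$ are minimally parametrized, then so is $J$; and the Krull dimensions satisfy $$\dim K[{\bf x}]/J=\sum_{i=1}^k\dim K[{\bf x}_i]/I_i+r-k.$$ -/

import Mathlib

namespace ToricSum

open MvPolynomial

/-- The monomial `t^a` of the Laurent polynomial ring `K[t_1^{±1}, …, t_m^{±1}]`, which is realised
as the group algebra of `ℤ^m`. -/
noncomputable def laurentMonomial (K : Type*) [Field K] {m : ℕ} (a : Fin m → ℤ) :
    AddMonoidAlgebra K (Fin m → ℤ) :=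
  AddMonoidAlgebra.single a 1

/-- The `K`-algebra morphism `K[x_i : i ∈ σ] → K[t_1^{±1}, …, t_m^{±1}]`, `x_i ↦ t^{α i}`. -/
noncomputable def monomialMap (K : Type*) [Field K] {σ : Type*} {m : ℕ} (α : σ → Fin m → ℤ) :
    MvPolynomial σ K →ₐ[K] AddMonoidAlgebra K (Fin m → ℤ) :=
  aeval fun i => laurentMonomial K (α i)

/-- A toric ideal: the kernel of a morphism sending each variable to a Laurent monomial. -/
def IsToric {K : Type*} [Field K] {σ : Type*} (I : Ideal (MvPolynomial σ K)) : Prop :=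
  ∃ (m : ℕ) (α : σ → Fin m → ℤ), RingHom.ker (monomialMap K α) = I

/-- A toric ideal with a parametrization `x_i ↦ Y_i` whose monomials `Y_i` form a minimal system of
generators of the algebra they generate: no `Y_i` lies in the algebra generated by the others. -/
def IsMinimallyParametrizedToric {K : Type*} [Field K] {σ : Type*}
    (I : Ideal (MvPolynomial σ K)) : Prop :=
  ∃ (m : ℕ) (α : σ → Fin m → ℤ),
    (∀ i, laurentMonomial K (α i) ∉
      Algebra.adjoin K ((fun j => laurentMonomial K (α j)) '' {j | j ≠ i})) ∧
    RingHom.ker (monomialMap K α) = I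

/-- An ideal of a polynomial ring that is homogeneous for the standard grading. -/
def IsHomogeneousIdeal {K : Type*} [Field K] {σ : Type*} (I : Ideal (MvPolynomial σ K)) : Prop :=
  letI : GradedAlgebra (homogeneousSubmodule σ K) := gradedAlgebra
  I.IsHomogeneous (homogeneousSubmodule σ K)

/-- The graph of a family of ideals of the rings `K[x_i]`, where `X i` is the set of variables
`x_i`: the vertices are the indices, and two different ones are joined when the variable sets
meet. -/
def varGraph {ι σ : Type*} (X : ι → Finset σ) : SimpleGraph ι where
  Adj i j := i ≠ j ∧ ∃ x, x ∈ X i ∧ x ∈ X j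
  symm := ⟨fun _ _ h => ⟨h.1.symm, h.2.imp fun _ hx => ⟨hx.2, hx.1⟩⟩⟩
  loopless := ⟨fun _ h => h.1 rfl⟩

/-- The union `x` of the variable sets. -/
def allVars {ι σ : Type*} (X : ι → Finset σ) : Set σ := {x | ∃ i, x ∈ X i}

/-- The inclusion `K[x_i] → K[x]` of polynomial rings. -/
noncomputable def inclHom (K : Type*) [Field K] {ι σ : Type*} (X : ι → Finset σ) (i : ι) :
    MvPolynomial (X i) K →ₐ[K] MvPolynomial (allVars X) K :=
  rename fun x : X i => (⟨x.1, i, x.2⟩ : allVars X)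

/-- The sum of the ideals `I i` of `K[x_i]`, each extended to `K[x]`. -/
noncomputable def idealSum {K : Type*} [Field K] {ι σ : Type*} [Fintype ι] (X : ι → Finset σ)
    (I : ∀ i, Ideal (MvPolynomial (X i) K)) : Ideal (MvPolynomial (allVars X) K) :=
  ∑ i, (I i).map (inclHom K X i)

end ToricSum

namespace ToricSum

open MvPolynomial

/-! A toric ideal is spanned by the binomials `x^u - x^v` whose exponents have equal weight, so it
depends only on the linear relations among the exponent vectors. These may therefore be taken in a
rational vector space. Homogeneity says that they can be chosen with a linear functional `l` equal
to 1 on each of them.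

Two such configurations sharing at most one variable `x` are glued in `(M × N)/⟨(α x, -β x)⟩`.
Splitting a relation `u = v` of the glued configuration into its two sides leaves a defect `t • (α
x, -β x)`, and `l` shows that `t` is a difference of degrees, hence an integer. The relation then
factors through a power of `x`, so the glued ideal is the sum of the two ideals
(`binomialIdeal_glue`). The dimension of a toric ring is the rank of its exponents, and gluing
lowers the total rank by one for a shared variable (`finrank_span_glue`). In the graded setting a
minimal parametrization exists exactly when the vectors are distinct, a property that survives
gluing (`glue_injOn`).

In a forest, each nonempty set of vertices contains one with at most one neighbour in the set.
Removing it gives an induction in which every edge costs one dimension, and a forest has `k - r`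
edges. Clearing denominators returns to Laurent monomials. -/

/-- The morphism `K[x_i : i ∈ σ] → K[M]` sending `x_i` to the monomial with exponent `α i`. -/
noncomputable def groupAlgebraMap (K : Type*) [Field K] {σ M : Type*} [AddCommMonoid M]
    (α : σ → M) : MvPolynomial σ K →ₐ[K] AddMonoidAlgebra K M :=
  aeval fun i => AddMonoidAlgebra.single (α i) 1

/-- The ideal spanned by the binomials `x^u - x^v` in the variables from `V` such that the
exponents `u` and `v` have the same weight with respect to `α`. -/
noncomputable def binomialIdeal (K : Type*) [Field K] {σ M : Type*} [AddCommMonoid M]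
    (V : Set σ) (α : σ → M) : Ideal (MvPolynomial σ K) :=
  Ideal.span {f | ∃ u v : σ →₀ ℕ, (u.support : Set σ) ⊆ V ∧ (v.support : Set σ) ⊆ V ∧
    Finsupp.linearCombination ℕ α u = Finsupp.linearCombination ℕ α v ∧
    f = monomial u 1 - monomial v 1}

/-! ### Toric ideals as binomial ideals. -/

section Binomials

variable {K : Type*} [Field K] {σ τ M N : Type*} [AddCommMonoid M] [AddCommMonoid N]

theorem monomialMap_eq_groupAlgebraMap {m : ℕ} (α : σ → Fin m → ℤ) :
    monomialMap K α = groupAlgebraMap K α := rfl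

theorem groupAlgebraMap_monomial (α : σ → M) (u : σ →₀ ℕ) (c : K) :
    groupAlgebraMap K α (monomial u c) =
      AddMonoidAlgebra.single (Finsupp.linearCombination ℕ α u) c := by
  rw [groupAlgebraMap, aeval_monomial]
  simp [AddMonoidAlgebra.single_pow, Finsupp.linearCombination_apply, Finsupp.prod, Finsupp.sum,
    AddMonoidAlgebra.single_mul_single]

theorem binomial_mem_ker_iff (α : σ → M) (u v : σ →₀ ℕ) :
    monomial u (1 : K) - monomial v 1 ∈ RingHom.ker (groupAlgebraMap K α) ↔
      Finsupp.linearCombination ℕ α u = Finsupp.linearCombination ℕ α v := by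
  rw [RingHom.mem_ker, map_sub, groupAlgebraMap_monomial, groupAlgebraMap_monomial, sub_eq_zero]
  exact AddMonoidAlgebra.single_left_inj one_ne_zero

/-- Modulo the binomials, every monomial equals a chosen representative of its weight. Hence `f` is
congruent to an expression in its image alone, which vanishes when `f` lies in the kernel. -/
theorem ker_groupAlgebraMap (α : σ → M) :
    RingHom.ker (groupAlgebraMap K α) = binomialIdeal K Set.univ α := by
  classical
  apply le_antisymm
  · let φ := Finsupp.linearCombination ℕ α
    let s : M → (σ →₀ ℕ) := Function.invFun φ
    have hs : ∀ u, φ (s (φ u)) = φ u := fun u => Function.invFun_eq ⟨u, rfl⟩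
    let L : AddMonoidAlgebra K M →ₗ[K] MvPolynomial σ K :=
      Finsupp.linearCombination K (fun m => monomial (s m) (1 : K)) ∘ₗ
        (AddMonoidAlgebra.coeffLinearEquiv K).toLinearMap
    have key : ∀ f, f - L (groupAlgebraMap K α f) ∈ binomialIdeal K Set.univ α := by
      intro f
      induction f using MvPolynomial.induction_on' with
      | monomial u a =>
        have e : monomial u a - L (groupAlgebraMap K α (monomial u a)) =
            C a * (monomial u 1 - monomial (s (φ u)) 1) := by
          rw [groupAlgebraMap_monomial]
          simp [L, φ, mul_sub, C_mul_monomial, smul_monomial]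
        rw [e]
        exact Ideal.mul_mem_left _ _ (Ideal.subset_span
          ⟨u, _, Set.subset_univ _, Set.subset_univ _, (hs u).symm, rfl⟩)
      | add p q hp hq =>
        rw [map_add, map_add, add_sub_add_comm]
        exact add_mem hp hq
    intro f hf
    have := key f
    rwa [(RingHom.mem_ker).1 hf, map_zero, sub_zero] at this
  · refine Ideal.span_le.2 ?_
    rintro f ⟨u, v, -, -, h, rfl⟩
    exact (binomial_mem_ker_iff α u v).2 h

theorem binomialIdeal_congr {V : Set σ} {α : σ → M} {β : σ → N}
    (h : ∀ u v : σ →₀ ℕ, (u.support : Set σ) ⊆ V → (v.support : Set σ) ⊆ V →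
      (Finsupp.linearCombination ℕ α u = Finsupp.linearCombination ℕ α v ↔
        Finsupp.linearCombination ℕ β u = Finsupp.linearCombination ℕ β v)) :
    binomialIdeal K V α = binomialIdeal K V β := by
  unfold binomialIdeal
  congr 1
  ext f
  constructor
  · rintro ⟨u, v, hu, hv, e, rfl⟩
    exact ⟨u, v, hu, hv, (h u v hu hv).1 e, rfl⟩
  · rintro ⟨u, v, hu, hv, e, rfl⟩
    exact ⟨u, v, hu, hv, (h u v hu hv).2 e, rfl⟩

/-- For injective `f`, the exponents supported on the range are exactly the push-forwards, and
pushing forward preserves weights. -/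
theorem map_rename_binomialIdeal_univ {f : σ → τ} (hf : Function.Injective f) (α : τ → M) :
    (binomialIdeal K Set.univ (α ∘ f)).map (rename f : MvPolynomial σ K →ₐ[K] MvPolynomial τ K) =
      binomialIdeal K (Set.range f) α := by
  classical
  unfold binomialIdeal
  rw [Ideal.map_span]
  congr 1
  have key : ∀ u : τ →₀ ℕ, (u.support : Set τ) ⊆ Set.range f →
      ∃ u', Finsupp.mapDomain f u' = u := by
    intro u hu
    refine (Finsupp.mem_range_mapDomain_iff f hf u).2 fun b hb => ?_
    by_contra h
    exact hb (hu (by simpa using h))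
  have hsupp : ∀ u : σ →₀ ℕ, ((Finsupp.mapDomain f u).support : Set τ) ⊆ Set.range f := by
    intro u x hx
    obtain ⟨y, -, rfl⟩ := Finset.mem_image.1 (Finsupp.mapDomain_support hx)
    exact ⟨y, rfl⟩
  ext g
  constructor
  · rintro ⟨_, ⟨u, v, -, -, h, rfl⟩, rfl⟩
    refine ⟨_, _, hsupp u, hsupp v, ?_, ?_⟩
    · simpa only [Finsupp.linearCombination_mapDomain] using h
    · simp [rename_monomial]
  · rintro ⟨u, v, hu, hv, h, rfl⟩
    obtain ⟨u, rfl⟩ := key u hu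
    obtain ⟨v, rfl⟩ := key v hv
    refine ⟨_, ⟨u, v, by simp, by simp, ?_, rfl⟩, by simp [rename_monomial]⟩
    simpa only [Finsupp.linearCombination_mapDomain] using h

end Binomials

/-! ### Krull dimension and transcendence degree. -/

section Dimension

/-- Two rings have the same Krull dimension if one is an integral extension of the other. -/
theorem ringKrullDim_eq_of_isIntegral {R S : Type*} [CommRing R] [CommRing S] [Algebra R S]
    [Algebra.IsIntegral R S] (h : Function.Injective (algebraMap R S)) :
    ringKrullDim R = ringKrullDim S := by
  have : FaithfulSMul R S := (faithfulSMul_iff_algebraMap_injective R S).2 h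
  apply le_antisymm
  -- Lying over and going up lift chains of primes; the other inequality is incomparability.
  · refine iSup_le fun l => ?_
    obtain ⟨⟨P, hP, hPl⟩⟩ := Ideal.nonempty_primesOver (S := S) l.head.asIdeal
    obtain ⟨L, hL, -⟩ := Ideal.exists_ltSeries_of_hasGoingUp l P
    rw [← hL]
    exact le_iSup (fun p : LTSeries (PrimeSpectrum S) => (p.length : WithBot ℕ∞)) L
  · exact Order.krullDim_le_of_strictMono (PrimeSpectrum.comap (algebraMap R S))
      fun I J hIJ => Ideal.IsIntegral.comap_lt_comap hIJ

/-- The Krull dimension of a domain of finite type over a field is its transcendence degree. -/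
theorem ringKrullDim_eq_card_of_isTranscendenceBasis {K : Type*} [Field K] {R : Type*}
    [CommRing R] [IsDomain R] [Algebra K R] [Algebra.FiniteType K R] {ι : Type*} [Finite ι]
    {x : ι → R} (hx : IsTranscendenceBasis K x) :
    ringKrullDim R = (Nat.card ι : WithBot ℕ∞) := by
  -- Noether normalization: the variables of the polynomial subring form a second transcendence
  -- basis.
  obtain ⟨s, g, hg, hgi⟩ := exists_integral_inj_algHom_of_fg K R
  let _ := g.toRingHom.toAlgebra
  have : Algebra.IsIntegral (MvPolynomial (Fin s) K) R := ⟨hgi⟩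
  have : IsScalarTower K (MvPolynomial (Fin s) K) R :=
    IsScalarTower.of_algebraMap_eq fun a => (g.commutes a).symm
  rw [← ringKrullDim_eq_of_isIntegral (R := MvPolynomial (Fin s) K) hg,
    MvPolynomial.ringKrullDim_of_isNoetherianRing, ringKrullDim_eq_zero_of_field, zero_add]
  have : FaithfulSMul (MvPolynomial (Fin s) K) R := (faithfulSMul_iff_algebraMap_injective _ _).2 hg
  have hy := (IsTranscendenceBasis.mvPolynomial (Fin s) K).algebraMap_comp (A := R)
  have := congrArg Cardinal.toNat (hx.lift_cardinalMk_eq hy)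
  rw [Cardinal.toNat_lift, Cardinal.toNat_lift] at this
  exact_mod_cast this.symm

end Dimension

/-! ### Dimension of a toric ring as a rank. -/

section Rank

variable {K : Type*} [Field K] {σ M : Type*} [AddCommGroup M] [Module ℚ M]

theorem linearCombination_nat_eq (α : σ → M) (u : σ →₀ ℕ) :
    Finsupp.linearCombination ℕ α u =
      Finsupp.linearCombination ℚ α (u.mapRange (Nat.cast : ℕ → ℚ) Nat.cast_zero) := by
  rw [Finsupp.linearCombination_apply, Finsupp.linearCombination_apply,
    Finsupp.sum_mapRange_index (by simp)]
  simp [Nat.cast_smul_eq_nsmul]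

/-- Denominators can be cleared in a rational linear combination. -/
theorem exists_nsmul_add_mem_closure {s : Set M} {w : M} (hw : w ∈ Submodule.span ℚ s) :
    ∃ n : ℕ, n ≠ 0 ∧ ∃ p ∈ AddSubmonoid.closure s, ∃ q ∈ AddSubmonoid.closure s,
      n • w + p = q := by
  induction hw using Submodule.span_induction with
  | mem x hx => exact ⟨1, one_ne_zero, 0, zero_mem _, x, AddSubmonoid.subset_closure hx, by simp⟩
  | zero => exact ⟨1, one_ne_zero, 0, zero_mem _, 0, zero_mem _, by simp⟩
  | add x y _ _ hx hy =>
    obtain ⟨n, hn, p, hp, q, hq, e⟩ := hx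
    obtain ⟨n', hn', p', hp', q', hq', e'⟩ := hy
    refine ⟨n * n', mul_ne_zero hn hn', n' • p + n • p', add_mem (nsmul_mem hp _) (nsmul_mem hp' _),
      n' • q + n • q', add_mem (nsmul_mem hq _) (nsmul_mem hq' _), ?_⟩
    rw [← e, ← e']
    module
  | smul a x _ hx =>
    obtain ⟨n, hn, p, hp, q, hq, e⟩ := hx
    have ha : (a.den * n) • a • x = a.num • n • x := by
      rw [← Nat.cast_smul_eq_nsmul ℚ, ← Int.cast_smul_eq_zsmul ℚ, ← Nat.cast_smul_eq_nsmul ℚ n,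
        smul_smul, smul_smul]
      congr 1
      push_cast
      rw [mul_right_comm, Rat.den_mul_eq_num]
    -- A negative numerator exchanges the roles of `p` and `q`, so that both stay in the monoid.
    rcases Int.le_total 0 a.num with h | h
    · obtain ⟨k, hk⟩ := Int.eq_ofNat_of_zero_le h
      refine ⟨a.den * n, mul_ne_zero a.den_ne_zero hn, k • p, nsmul_mem hp _, k • q,
        nsmul_mem hq _, ?_⟩
      rw [ha, hk, ← e]
      simp
    · obtain ⟨k, hk⟩ := Int.exists_eq_neg_ofNat h
      refine ⟨a.den * n, mul_ne_zero a.den_ne_zero hn, k • q, nsmul_mem hq _, k • p,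
        nsmul_mem hp _, ?_⟩
      rw [ha, hk, ← e]
      simp

theorem single_mem_range_of_mem_closure {K σ M : Type*} [Field K] [AddCommMonoid M] {α : σ → M}
    {p : M}
    (hp : p ∈ AddSubmonoid.closure (Set.range α)) :
    AddMonoidAlgebra.single p (1 : K) ∈ (groupAlgebraMap K α).range := by
  rw [← Submodule.span_nat_eq_addSubmonoidClosure, Submodule.mem_toAddSubmonoid,
    Finsupp.mem_span_range_iff_exists_finsupp] at hp
  obtain ⟨c, rfl⟩ := hp
  exact ⟨monomial c 1, by
    simp [groupAlgebraMap_monomial, Finsupp.linearCombination_apply]⟩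

/-- The dimension of a toric ring is the rank of the exponents that generate it. -/
theorem ringKrullDim_quotient_ker_groupAlgebraMap [Finite σ] (α : σ → M) :
    ringKrullDim (MvPolynomial σ K ⧸ RingHom.ker (groupAlgebraMap K α)) =
      (Module.finrank ℚ (Submodule.span ℚ (Set.range α)) : WithBot ℕ∞) := by
  classical
  obtain ⟨b, hb, hspan, hli⟩ := exists_linearIndependent ℚ (Set.range α)
  have : Finite b := (Set.finite_range α).subset hb
  let R := (groupAlgebraMap K α).range
  have hRf : Algebra.FiniteType K R :=
    Algebra.FiniteType.of_surjective (groupAlgebraMap K α).rangeRestrict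
      (groupAlgebraMap K α).rangeRestrict_surjective
  let x : b → R := fun v => ⟨AddMonoidAlgebra.single v.1 1,
    single_mem_range_of_mem_closure (AddSubmonoid.subset_closure (hb v.2))⟩
  -- Linear independence of `b` leaves only trivial binomials in the kernel.
  have hxi : AlgebraicIndependent K x := by
    have hval : R.val.comp (aeval x) = groupAlgebraMap K (Subtype.val : b → M) := by
      ext i; simp [x, groupAlgebraMap]
    have : Function.Injective (groupAlgebraMap K (Subtype.val : b → M)) := by
      rw [← AlgHom.coe_toRingHom, RingHom.injective_iff_ker_eq_bot]
      change RingHom.ker (groupAlgebraMap K (Subtype.val : b → M)) = ⊥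
      rw [ker_groupAlgebraMap, binomialIdeal, Ideal.span_eq_bot]
      rintro f ⟨u, v, -, -, h, rfl⟩
      rw [linearCombination_nat_eq, linearCombination_nat_eq] at h
      have := Finsupp.mapRange_injective _ Nat.cast_zero Nat.cast_injective (hli h)
      rw [this, sub_self]
    rw [← hval, AlgHom.coe_comp] at this
    exact this.of_comp
  have hx : IsTranscendenceBasis K x := by
    rw [hxi.isTranscendenceBasis_iff_isAlgebraic]
    let A := Algebra.adjoin K (Set.range x)
    have hA : ∀ p ∈ AddSubmonoid.closure b, ∃ a ∈ A, (a : AddMonoidAlgebra K M) =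
        AddMonoidAlgebra.single p 1 := by
      intro p hp
      induction hp using AddSubmonoid.closure_induction with
      | mem y hy => exact ⟨x ⟨y, hy⟩, Algebra.subset_adjoin ⟨_, rfl⟩, rfl⟩
      | zero => exact ⟨1, one_mem _, rfl⟩
      | add y z _ _ hy hz =>
        obtain ⟨a, ha, ha'⟩ := hy
        obtain ⟨c, hc, hc'⟩ := hz
        exact ⟨a * c, mul_mem ha hc, by
          simp [ha', hc', AddMonoidAlgebra.single_mul_single]⟩
    have hgen : ∀ i, IsAlgebraic A ((groupAlgebraMap K α).rangeRestrict (X i)) := by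
      intro i
      obtain ⟨n, hn, p, hp, q, hq, e⟩ := exists_nsmul_add_mem_closure
        (s := b) (w := α i) (hspan ▸ Submodule.subset_span ⟨i, rfl⟩)
      obtain ⟨P, hP, hP'⟩ := hA p hp
      obtain ⟨Q, hQ, hQ'⟩ := hA q hq
      -- A relation `n • α i + p = q` makes the generator a root of `t^p X^n - t^q`, which is
      -- nonzero because `n ≠ 0`.
      refine ⟨Polynomial.C ⟨P, hP⟩ * Polynomial.X ^ n - Polynomial.C ⟨Q, hQ⟩, ?_, ?_⟩
      · intro h
        have := congrArg (fun r => Polynomial.coeff r n) h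
        simp only [Polynomial.coeff_sub, Polynomial.coeff_C_mul, Polynomial.coeff_X_pow_self,
          mul_one, Polynomial.coeff_C, if_neg hn, Polynomial.coeff_zero] at this
        have : (P : AddMonoidAlgebra K M) = 0 := by
          rw [show P = 0 by simpa using congrArg Subtype.val this]; rfl
        rw [hP'] at this
        simp at this
      · rw [map_sub, map_mul, map_pow, Polynomial.aeval_C, Polynomial.aeval_C, Polynomial.aeval_X,
          sub_eq_zero]
        apply Subtype.ext
        change (P : AddMonoidAlgebra K M) * (groupAlgebraMap K α (X i)) ^ n = Q
        rw [hP', hQ', ← e]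
        simp [groupAlgebraMap, AddMonoidAlgebra.single_pow, AddMonoidAlgebra.single_mul_single,
          add_comm]
    refine ⟨fun r => ?_⟩
    obtain ⟨f, rfl⟩ := (groupAlgebraMap K α).rangeRestrict_surjective r
    induction f using MvPolynomial.induction_on with
    | C a =>
      have : (groupAlgebraMap K α).rangeRestrict (C a) = algebraMap A R (algebraMap K A a) := by
        exact ((groupAlgebraMap K α).rangeRestrict.commutes a)
      rw [this]; exact isAlgebraic_algebraMap _
    | add p q hp hq => rw [map_add]; exact hp.add hq
    | mul_X p i hp => rw [map_mul]; exact hp.mul (hgen i)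
  have hq : (MvPolynomial σ K ⧸ RingHom.ker (groupAlgebraMap K α)) ≃+* R :=
    RingHom.quotientKerEquivRange (groupAlgebraMap K α).toRingHom
  have := Fintype.ofFinite b
  rw [ringKrullDim_eq_of_ringEquiv hq, ringKrullDim_eq_card_of_isTranscendenceBasis hx, ← hspan,
    finrank_span_set_eq_card hli, Set.toFinset_card, Nat.card_eq_fintype_card]

end Rank

/-! ### Gluing two configurations along a common variable. -/

section Glue

variable {σ M N : Type*} [AddCommGroup M] [Module ℚ M] [AddCommGroup N] [Module ℚ N]

theorem linearCombination_nat_congr {σ M : Type*} [AddCommMonoid M] {α β : σ → M} {V : Set σ} (h : ∀ c ∈ V, α c = β c)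
    {u : σ →₀ ℕ} (hu : (u.support : Set σ) ⊆ V) :
    Finsupp.linearCombination ℕ α u = Finsupp.linearCombination ℕ β u := by
  rw [Finsupp.linearCombination_apply, Finsupp.linearCombination_apply]
  exact Finsupp.sum_congr fun c hc => by rw [h c (hu hc)]

theorem map_linearCombination_nat {σ M N F : Type*} [AddCommMonoid M] [AddCommMonoid N]
    [FunLike F M N] [AddMonoidHomClass F M N] (L : F) (α : σ → M) (u : σ →₀ ℕ) :
    L (Finsupp.linearCombination ℕ α u) = Finsupp.linearCombination ℕ (fun c => L (α c)) u := by
  rw [Finsupp.linearCombination_apply, Finsupp.linearCombination_apply, map_finsuppSum]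
  simp

theorem apply_linearCombination_eq_degree {V : Set σ} {α : σ → M} {l : M →ₗ[ℚ] ℚ}
    (h : ∀ c ∈ V, l (α c) = 1) {u : σ →₀ ℕ} (hu : (u.support : Set σ) ⊆ V) :
    l (Finsupp.linearCombination ℕ α u) = u.degree := by
  rw [map_linearCombination_nat, linearCombination_nat_congr (β := fun _ => (1 : ℚ)) h hu,
    Finsupp.linearCombination_apply]
  simp [Finsupp.sum, Finsupp.degree_apply]

/-- The relations that identify `α c` with `β c` for the common variables `c`. -/
def glueRelations (α : σ → M) (β : σ → N) (V W : Set σ) : Submodule ℚ (M × N) :=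
  Submodule.span ℚ ((fun c => (α c, -β c)) '' (V ∩ W))

open scoped Classical in
/-- The configuration obtained from `α` on `V` and `β` on `W` by identifying the vectors of the
common variables. -/
noncomputable def glue (α : σ → M) (β : σ → N) (V W : Set σ) (c : σ) :
    (M × N) ⧸ glueRelations α β V W :=
  Submodule.Quotient.mk (if c ∈ V then (α c, 0) else (0, β c))

variable {α : σ → M} {β : σ → N} {V W : Set σ}

theorem glue_of_mem_left {c : σ} (hc : c ∈ V) :
    glue α β V W c = (glueRelations α β V W).mkQ (α c, 0) := by
  simp [glue, hc]

theorem glue_of_mem_right {c : σ} (hc : c ∈ W) :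
    glue α β V W c = (glueRelations α β V W).mkQ (0, β c) := by
  by_cases h : c ∈ V
  · rw [glue_of_mem_left h, ← sub_eq_zero, ← map_sub, Submodule.mkQ_apply,
      Submodule.Quotient.mk_eq_zero]
    exact Submodule.subset_span ⟨c, ⟨h, hc⟩, by simp⟩
  · simp [glue, h]

theorem mem_glueRelations_cases (hVW : (V ∩ W).Subsingleton) {z : M × N}
    (hz : z ∈ glueRelations α β V W) :
    z = 0 ∨ ∃ c ∈ V ∩ W, ∃ t : ℚ, z = (t • α c, -(t • β c)) := by
  rcases hVW.eq_empty_or_singleton with h | ⟨c, h⟩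
  · left
    simpa [glueRelations, h] using hz
  · right
    rw [glueRelations, h, Set.image_singleton, Submodule.mem_span_singleton] at hz
    obtain ⟨t, rfl⟩ := hz
    exact ⟨c, h ▸ rfl, t, by simp⟩

/-- The degree functional of the glued configuration. -/
noncomputable def glueDegree (l : M →ₗ[ℚ] ℚ) (l' : N →ₗ[ℚ] ℚ) (hl : ∀ c ∈ V, l (α c) = 1)
    (hl' : ∀ c ∈ W, l' (β c) = 1) : ((M × N) ⧸ glueRelations α β V W) →ₗ[ℚ] ℚ :=
  (glueRelations α β V W).liftQ (l.coprod l') <| Submodule.span_le.2 <| by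
    rintro _ ⟨c, ⟨hc, hc'⟩, rfl⟩
    simp [hl c hc, hl' c hc']

theorem glueDegree_glue (l : M →ₗ[ℚ] ℚ) (l' : N →ₗ[ℚ] ℚ) (hl : ∀ c ∈ V, l (α c) = 1)
    (hl' : ∀ c ∈ W, l' (β c) = 1) :
    ∀ c ∈ V ∪ W, glueDegree l l' hl hl' (glue α β V W c) = 1 := by
  rintro c (hc | hc)
  · rw [glue_of_mem_left hc]
    exact (Submodule.liftQ_apply _ _ _).trans (by simp [hl c hc])
  · rw [glue_of_mem_right hc]
    exact (Submodule.liftQ_apply _ _ _).trans (by simp [hl' c hc])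

/-- Two glued vectors agree only up to a multiple `t` of the relation of the shared variable `x`.
Degrees force `t = 0` when both come from the same side. Across sides they force `t = 1`, so that
both variables equal `x`. -/
theorem glue_injOn (l : M →ₗ[ℚ] ℚ) (l' : N →ₗ[ℚ] ℚ) (hl : ∀ c ∈ V, l (α c) = 1)
    (hl' : ∀ c ∈ W, l' (β c) = 1) (hVW : (V ∩ W).Subsingleton) (hα : V.InjOn α)
    (hβ : W.InjOn β) : (V ∪ W).InjOn (glue α β V W) := by
  have key : ∀ c ∈ V, ∀ d ∈ W, glue α β V W c = glue α β V W d → c = d := by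
    intro c hc d hd h
    rw [glue_of_mem_left hc, glue_of_mem_right hd, ← sub_eq_zero, ← map_sub, Submodule.mkQ_apply,
      Submodule.Quotient.mk_eq_zero] at h
    rcases mem_glueRelations_cases hVW h with h | ⟨x, ⟨hx, hx'⟩, t, h⟩
    · have := congrArg l (congrArg Prod.fst h)
      simp [hl c hc] at this
    · have h1 : α c = t • α x := by simpa using congrArg Prod.fst h
      have h2 : β d = t • β x := by simpa using congrArg Prod.snd h
      have ht : t = 1 := by
        have := congrArg l h1
        rw [map_smul, hl c hc, hl x hx] at this
        simpa using this.symm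
      rw [ht, one_smul] at h1 h2
      exact (hα hc hx h1).trans (hβ hd hx' h2).symm
  rintro c (hc | hc) d (hd | hd) h
  · rw [glue_of_mem_left hc, glue_of_mem_left hd, ← sub_eq_zero, ← map_sub, Submodule.mkQ_apply,
      Submodule.Quotient.mk_eq_zero] at h
    apply hα hc hd
    rcases mem_glueRelations_cases hVW h with h | ⟨x, ⟨hx, hx'⟩, t, h⟩
    · simpa [sub_eq_zero] using h
    · have ht : t = 0 := by
        have := congrArg l' (congrArg Prod.snd h)
        simpa [hl' x hx'] using this.symm
      simpa [ht, sub_eq_zero] using h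
  · exact key c hc d hd h
  · exact (key d hd c hc h.symm).symm
  · rw [glue_of_mem_right hc, glue_of_mem_right hd, ← sub_eq_zero, ← map_sub, Submodule.mkQ_apply,
      Submodule.Quotient.mk_eq_zero] at h
    apply hβ hc hd
    rcases mem_glueRelations_cases hVW h with h | ⟨x, ⟨hx, hx'⟩, t, h⟩
    · simpa [sub_eq_zero] using h
    · have ht : t = 0 := by
        have := congrArg l (congrArg Prod.fst h)
        simpa [hl x hx] using this.symm
      simpa [ht, sub_eq_zero] using h

theorem finrank_glueRelations (l : M →ₗ[ℚ] ℚ) (hl : ∀ c ∈ V, l (α c) = 1)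
    (hVW : (V ∩ W).Subsingleton) :
    Module.finrank ℚ (glueRelations α β V W) = (V ∩ W).ncard := by
  rcases hVW.eq_empty_or_singleton with h | ⟨c, h⟩
  · rw [glueRelations, h, Set.image_empty, Submodule.span_empty, finrank_bot, Set.ncard_empty]
  · rw [glueRelations, h, Set.image_singleton, Set.ncard_singleton]
    refine finrank_span_singleton fun h0 => ?_
    have hc : c ∈ V ∩ W := h ▸ rfl
    have := congrArg l (congrArg Prod.fst h0)
    simp [hl c hc.1] at this

/-- The glued span is the image of the product of the two spans, and the relations lie inside that
product. Their rank is `(V ∩ W).ncard` because `l` shows that a shared vector is nonzero. -/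
theorem finrank_span_glue [Module.Finite ℚ M] [Module.Finite ℚ N] (l : M →ₗ[ℚ] ℚ)
    (hl : ∀ c ∈ V, l (α c) = 1) (hVW : (V ∩ W).Subsingleton) :
    Module.finrank ℚ (Submodule.span ℚ (glue α β V W '' (V ∪ W))) + (V ∩ W).ncard =
      Module.finrank ℚ (Submodule.span ℚ (α '' V)) +
        Module.finrank ℚ (Submodule.span ℚ (β '' W)) := by
  set D := glueRelations α β V W with hD
  set P := (Submodule.span ℚ (α '' V)).prod (Submodule.span ℚ (β '' W)) with hP
  have hle : D ≤ P := by
    refine Submodule.span_le.2 ?_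
    rintro _ ⟨c, hc, rfl⟩
    exact ⟨Submodule.subset_span ⟨c, hc.1, rfl⟩,
      neg_mem (Submodule.subset_span ⟨c, hc.2, rfl⟩)⟩
  have hmap : Submodule.span ℚ (glue α β V W '' (V ∪ W)) = P.map D.mkQ := by
    apply le_antisymm
    · refine Submodule.span_le.2 ?_
      rintro _ ⟨c, hc | hc, rfl⟩
      · rw [glue_of_mem_left hc]
        exact ⟨_, ⟨Submodule.subset_span ⟨c, hc, rfl⟩, zero_mem _⟩, rfl⟩
      · rw [glue_of_mem_right hc]
        exact ⟨_, ⟨zero_mem _, Submodule.subset_span ⟨c, hc, rfl⟩⟩, rfl⟩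
    · rintro _ ⟨⟨m, n⟩, ⟨hm, hn⟩, rfl⟩
      have h1 : Submodule.span ℚ (α '' V) ≤ (Submodule.span ℚ (glue α β V W '' (V ∪ W))).comap
          (D.mkQ ∘ₗ LinearMap.inl ℚ M N) := by
        refine Submodule.span_le.2 ?_
        rintro _ ⟨c, hc, rfl⟩
        exact Submodule.subset_span ⟨c, Or.inl hc, glue_of_mem_left hc⟩
      have h2 : Submodule.span ℚ (β '' W) ≤ (Submodule.span ℚ (glue α β V W '' (V ∪ W))).comap
          (D.mkQ ∘ₗ LinearMap.inr ℚ M N) := by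
        refine Submodule.span_le.2 ?_
        rintro _ ⟨c, hc, rfl⟩
        exact Submodule.subset_span ⟨c, Or.inr hc, glue_of_mem_right hc⟩
      have := add_mem (Submodule.mem_comap.1 (h1 hm)) (Submodule.mem_comap.1 (h2 hn))
      rwa [LinearMap.comp_apply, LinearMap.comp_apply, ← map_add, LinearMap.inl_apply,
        LinearMap.inr_apply, Prod.mk_add_mk, add_zero, zero_add] at this
  have hker : Module.finrank ℚ (D.mkQ.domRestrict P).ker = Module.finrank ℚ D := by
    rw [LinearMap.ker_domRestrict, Submodule.ker_mkQ]
    exact (Submodule.submoduleOfEquivOfLe hle).finrank_eq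
  have hrank := LinearMap.finrank_range_add_finrank_ker (D.mkQ.domRestrict P)
  rw [hker, LinearMap.range_domRestrict, ← hmap, finrank_glueRelations l hl hVW] at hrank
  rw [hrank, ← Module.finrank_prod]
  exact LinearEquiv.finrank_eq
    { toFun := fun z => (⟨z.1.1, z.2.1⟩, ⟨z.1.2, z.2.2⟩)
      invFun := fun z => ⟨(z.1, z.2), z.1.2, z.2.2⟩
      map_add' := fun _ _ => rfl
      map_smul' := fun _ _ => rfl }

theorem binomialIdeal_glue (K : Type*) [Field K] (l : M →ₗ[ℚ] ℚ)
    (hl : ∀ c ∈ V, l (α c) = 1) (hVW : (V ∩ W).Subsingleton) :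
    binomialIdeal K (V ∪ W) (glue α β V W) = binomialIdeal K V α ⊔ binomialIdeal K W β := by
  classical
  have hleft : ∀ u : σ →₀ ℕ, (u.support : Set σ) ⊆ V →
      Finsupp.linearCombination ℕ (glue α β V W) u =
        (glueRelations α β V W).mkQ (Finsupp.linearCombination ℕ α u, 0) := by
    intro u hu
    rw [linearCombination_nat_congr (fun c hc => glue_of_mem_left hc) hu]
    exact (map_linearCombination_nat ((glueRelations α β V W).mkQ ∘ₗ LinearMap.inl ℚ M N) α u).symm
  have hright : ∀ u : σ →₀ ℕ, (u.support : Set σ) ⊆ W →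
      Finsupp.linearCombination ℕ (glue α β V W) u =
        (glueRelations α β V W).mkQ (0, Finsupp.linearCombination ℕ β u) := by
    intro u hu
    rw [linearCombination_nat_congr (fun c hc => glue_of_mem_right hc) hu]
    exact (map_linearCombination_nat ((glueRelations α β V W).mkQ ∘ₗ LinearMap.inr ℚ M N) β u).symm
  apply le_antisymm
  · have key : ∀ u₁ v₁ u₂ v₂ w : σ →₀ ℕ, (u₁.support : Set σ) ⊆ V → (v₁.support : Set σ) ⊆ V →
        (u₂.support : Set σ) ⊆ W → (v₂.support : Set σ) ⊆ W → (w.support : Set σ) ⊆ V ∩ W →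
        Finsupp.linearCombination ℕ α u₁ = Finsupp.linearCombination ℕ α (v₁ + w) →
        Finsupp.linearCombination ℕ β (u₂ + w) = Finsupp.linearCombination ℕ β v₂ →
        monomial (u₁ + u₂) (1 : K) - monomial (v₁ + v₂) 1 ∈
          binomialIdeal K V α ⊔ binomialIdeal K W β := by
      intro u₁ v₁ u₂ v₂ w hu₁ hv₁ hu₂ hv₂ hw h₁ h₂
      have hadd : ∀ {p q : σ →₀ ℕ} {U : Set σ}, (p.support : Set σ) ⊆ U →
          (q.support : Set σ) ⊆ U → ((p + q).support : Set σ) ⊆ U := by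
        intro p q U hp hq c hc
        rcases Finset.mem_union.1 (Finsupp.support_add hc) with h | h
        exacts [hp h, hq h]
      have m₁ : monomial u₁ (1 : K) - monomial (v₁ + w) 1 ∈ binomialIdeal K V α :=
        Ideal.subset_span ⟨_, _, hu₁, hadd hv₁ (hw.trans Set.inter_subset_left), h₁, rfl⟩
      have m₂ : monomial (u₂ + w) (1 : K) - monomial v₂ 1 ∈ binomialIdeal K W β :=
        Ideal.subset_span ⟨_, _, hadd hu₂ (hw.trans Set.inter_subset_right), hv₂, h₂, rfl⟩
      -- The intermediate monomial `u₂ + v₁ + w` links the two binomials.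
      have e : monomial (u₁ + u₂) (1 : K) - monomial (v₁ + v₂) 1 =
          monomial u₂ 1 * (monomial u₁ 1 - monomial (v₁ + w) 1) +
            monomial v₁ 1 * (monomial (u₂ + w) 1 - monomial v₂ 1) := by
        simp only [mul_sub, monomial_mul, one_mul]
        rw [add_comm u₂ u₁, show u₂ + (v₁ + w) = v₁ + (u₂ + w) by abel]
        ring
      rw [e]
      exact Ideal.add_mem _ (Ideal.mul_mem_left _ _ (Ideal.mem_sup_left m₁))
        (Ideal.mul_mem_left _ _ (Ideal.mem_sup_right m₂))
    refine Ideal.span_le.2 ?_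
    rintro f ⟨u, v, hu, hv, h, rfl⟩
    have hsplit : ∀ u : σ →₀ ℕ, (u.support : Set σ) ⊆ V ∪ W → ∃ u₁ u₂ : σ →₀ ℕ,
        (u₁.support : Set σ) ⊆ V ∧ (u₂.support : Set σ) ⊆ W ∧ u = u₁ + u₂ := by
      intro u hu
      refine ⟨u.filter (· ∈ V), u.filter (¬ · ∈ V), fun c hc => ?_, fun c hc => ?_,
        (Finsupp.filter_add_filter_not u _).symm⟩
      · rw [Finsupp.support_filter] at hc
        exact (Finset.mem_filter.1 hc).2
      · rw [Finsupp.support_filter] at hc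
        have := Finset.mem_filter.1 hc
        exact (hu this.1).resolve_left this.2
    obtain ⟨u₁, u₂, hu₁, hu₂, rfl⟩ := hsplit u hu
    obtain ⟨v₁, v₂, hv₁, hv₂, rfl⟩ := hsplit v hv
    have hz : (Finsupp.linearCombination ℕ α u₁ - Finsupp.linearCombination ℕ α v₁,
        Finsupp.linearCombination ℕ β u₂ - Finsupp.linearCombination ℕ β v₂) ∈
          glueRelations α β V W := by
      rw [map_add, map_add, hleft _ hu₁, hleft _ hv₁, hright _ hu₂, hright _ hv₂, ← map_add,
        ← map_add, ← sub_eq_zero, ← map_sub, Submodule.mkQ_apply,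
        Submodule.Quotient.mk_eq_zero] at h
      simpa using h
    rcases mem_glueRelations_cases hVW hz with h | ⟨x, hx, t, h⟩
    · rw [Prod.mk_eq_zero, sub_eq_zero, sub_eq_zero] at h
      exact key u₁ v₁ u₂ v₂ 0 hu₁ hv₁ hu₂ hv₂ (by simp) (by simpa using h.1) (by simpa using h.2)
    · rw [Prod.mk.injEq] at h
      obtain ⟨h₁, h₂⟩ := h
      -- The degree functional makes the rational coefficient `t` an integer, so it can serve as an
      -- exponent of the shared variable.
      have ht : (u₁.degree : ℚ) - v₁.degree = t := by
        have := congrArg l h₁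
        rwa [map_sub, apply_linearCombination_eq_degree hl hu₁,
          apply_linearCombination_eq_degree hl hv₁, map_smul, hl x hx.1, smul_eq_mul,
          mul_one] at this
      have hs : ∀ n : ℕ, ((Finsupp.single x n).support : Set σ) ⊆ V ∩ W := fun n c hc => by
        rw [Finset.mem_singleton.1 (Finsupp.support_single_subset hc)]
        exact hx
      -- The sign of `t` decides which side of the relation receives the power of `x`.
      rcases le_total v₁.degree u₁.degree with hd | hd
      · have htn : t = ((u₁.degree - v₁.degree : ℕ) : ℚ) := by rw [Nat.cast_sub hd, ht]
        rw [htn, Nat.cast_smul_eq_nsmul] at h₁ h₂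
        refine key u₁ v₁ u₂ v₂ (Finsupp.single x (u₁.degree - v₁.degree)) hu₁ hv₁ hu₂ hv₂ (hs _) ?_ ?_
        · rw [map_add, Finsupp.linearCombination_single, ← h₁]
          abel
        · rw [map_add, Finsupp.linearCombination_single, ← sub_eq_zero, add_sub_right_comm, h₂]
          abel
      · have htn : t = -((v₁.degree - u₁.degree : ℕ) : ℚ) := by
          rw [Nat.cast_sub hd, ← ht]
          ring
        rw [htn, neg_smul, Nat.cast_smul_eq_nsmul] at h₁ h₂
        rw [← neg_sub]
        refine neg_mem (key v₁ u₁ v₂ u₂ (Finsupp.single x (v₁.degree - u₁.degree))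
          hv₁ hu₁ hv₂ hu₂ (hs _) ?_ ?_)
        · rw [map_add, Finsupp.linearCombination_single, sub_eq_iff_eq_add.1 h₁]
          abel
        · rw [map_add, Finsupp.linearCombination_single, sub_eq_iff_eq_add.1 h₂]
          abel
  · refine sup_le (Ideal.span_mono ?_) (Ideal.span_mono ?_)
    · rintro f ⟨u, v, hu, hv, h, rfl⟩
      exact ⟨u, v, hu.trans Set.subset_union_left, hv.trans Set.subset_union_left,
        by rw [hleft u hu, hleft v hv, h], rfl⟩
    · rintro f ⟨u, v, hu, hv, h, rfl⟩
      exact ⟨u, v, hu.trans Set.subset_union_right, hv.trans Set.subset_union_right,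
        by rw [hright u hu, hright v hv, h], rfl⟩

end Glue

/-! ### Counting in forests. -/

section Graph

variable {ι : Type*} (G : SimpleGraph ι)

theorem degree_toSimpleGraph [Fintype ι] [DecidableRel G.Adj] (c : G.ConnectedComponent)
    [DecidableRel c.toSimpleGraph.Adj] [Fintype c] (v : c) :
    c.toSimpleGraph.degree v = G.degree v := by
  classical
  rw [← SimpleGraph.card_neighborFinset_eq_degree, ← SimpleGraph.card_neighborFinset_eq_degree]
  refine Finset.card_bij (fun w _ => w.1) ?_ ?_ ?_
  · intro w hw
    exact (G.mem_neighborFinset _ _).2 ((c.toSimpleGraph.mem_neighborFinset _ _).1 hw)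
  · intro a _ b _ h
    exact Subtype.ext h
  · intro w hw
    have hw' : G.Adj v w := by simpa using hw
    have hwc : w ∈ c := by
      have h1 : G.connectedComponentMk v.1 = c := v.2
      rw [← h1]
      exact SimpleGraph.ConnectedComponent.sound hw'.symm.reachable
    exact ⟨⟨w, hwc⟩, (c.toSimpleGraph.mem_neighborFinset _ _).2 hw', rfl⟩

/-- The handshake lemma for a forest. -/
theorem sum_degree_add_card_connectedComponent [Fintype ι] [DecidableRel G.Adj]
    (h : ∀ c : G.ConnectedComponent, c.toSimpleGraph.IsTree) :
    ∑ v, G.degree v + 2 * Nat.card G.ConnectedComponent = 2 * Fintype.card ι := by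
  classical
  -- On a tree the degrees sum to twice the number of edges, which is one less than the number of
  -- vertices.
  have key : ∀ c : G.ConnectedComponent,
      ∑ v : {v // G.connectedComponentMk v = c}, G.degree v + 2 =
        2 * Fintype.card {v // G.connectedComponentMk v = c} := by
    intro c
    have e := (h c).card_edgeFinset
    have e' := c.toSimpleGraph.sum_degrees_eq_twice_card_edges
    simp only [degree_toSimpleGraph] at e'
    have h1 : ∑ v : {v // G.connectedComponentMk v = c}, G.degree v = ∑ v : c, G.degree v := by
      refine Fintype.sum_equiv (Equiv.refl _) _ _ fun _ => rfl
    have h2 : Fintype.card {v // G.connectedComponentMk v = c} = Fintype.card c :=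
      Fintype.card_congr (Equiv.refl _)
    rw [h1, h2, ← e, e', mul_add, mul_one]
  have := Fintype.sum_congr _ _ key
  rw [Finset.sum_add_distrib, ← Finset.mul_sum,
    Fintype.sum_fiberwise G.connectedComponentMk (fun v => G.degree v)] at this
  have hc : ∑ c, Fintype.card {v // G.connectedComponentMk v = c} = Fintype.card ι := by
    rw [← Fintype.card_sigma]
    exact Fintype.card_congr (Equiv.sigmaFiberEquiv _)
  rw [hc] at this
  rw [← this, Nat.card_eq_fintype_card]
  simp [mul_comm]

/-- A cycle stays inside the component of its base point. -/
theorem isAcyclic_of_forall_isTree (h : ∀ c : G.ConnectedComponent, c.toSimpleGraph.IsTree) :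
    G.IsAcyclic := by
  classical
  intro v w hw
  have hs : ∀ x ∈ w.support, x ∈ (G.connectedComponentMk v).supp := fun x hx =>
    SimpleGraph.ConnectedComponent.sound (w.takeUntil x hx).reachable.symm
  have hc : (w.induce _ hs).IsCycle := by
    refine SimpleGraph.Walk.IsCycle.of_map (f := (SimpleGraph.Embedding.induce _).toHom) ?_
    rwa [SimpleGraph.Walk.map_induce]
  exact (h (G.connectedComponentMk v)).isAcyclic _ hc

open scoped Classical in
/-- A nonempty set of vertices of a forest has a vertex with at most one neighbour in the set. -/
theorem exists_card_filter_adj_le_one (h : G.IsAcyclic) {S : Finset ι} (hS : S.Nonempty) :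
    ∃ i ∈ S, (S.filter (G.Adj i)).card ≤ 1 := by
  -- Otherwise the induced forest has degree sum at least `2 * S.card`, whereas the handshake lemma
  -- makes it smaller by twice the positive number of components.
  by_contra! hcon
  let H : SimpleGraph S := G.comap (Function.Embedding.subtype (· ∈ S))
  have hH : H.IsAcyclic := h.of_comap _
  have hsum := sum_degree_add_card_connectedComponent H hH.isTree_connectedComponent
  have hdeg : ∀ v : S, 2 ≤ H.degree v := by
    intro v
    refine (hcon v v.2).trans_le (Finset.card_le_card_of_surjOn Subtype.val ?_)
    intro w hw
    have := Finset.mem_filter.1 hw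
    exact ⟨⟨w, this.1⟩, (H.mem_neighborFinset _ _).2 this.2, rfl⟩
  have hle : ∑ _v : S, 2 ≤ ∑ v, H.degree v := Finset.sum_le_sum fun v _ => hdeg v
  have : Nonempty H.ConnectedComponent := ⟨H.connectedComponentMk ⟨_, hS.choose_spec⟩⟩
  have : 0 < Nat.card H.ConnectedComponent := Nat.card_pos
  simp only [Finset.sum_const, Finset.card_univ, smul_eq_mul] at hle
  omega

end Graph

/-! ### Graded rational configurations and toric ideals. -/

/-- The ideal `J`, whose generators only involve the variables from `V`, is toric with respect to a
rational configuration that lies in an affine hyperplane and spans a space of dimension `d`;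
the configuration is injective if `p` holds. -/
def IsGradedToric {K : Type*} [Field K] {σ : Type*} (V : Set σ) (J : Ideal (MvPolynomial σ K))
    (d : ℕ) (p : Prop) : Prop :=
  ∃ (M : Type) (_ : AddCommGroup M) (_ : Module ℚ M) (_ : Module.Finite ℚ M) (α : σ → M)
    (l : M →ₗ[ℚ] ℚ), (∀ c ∈ V, l (α c) = 1) ∧ J = binomialIdeal K V α ∧
    Module.finrank ℚ (Submodule.span ℚ (α '' V)) = d ∧ (p → V.InjOn α)

section GradedToric

variable {K : Type*} [Field K] {σ τ : Type*}

theorem isGradedToric_bot (p : Prop) :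
    IsGradedToric (∅ : Set σ) (⊥ : Ideal (MvPolynomial σ K)) 0 p := by
  refine ⟨ℚ, inferInstance, inferInstance, inferInstance, 0, 0, by simp, ?_, ?_, by simp⟩
  · symm
    rw [binomialIdeal, Ideal.span_eq_bot]
    rintro f ⟨u, v, hu, hv, -, rfl⟩
    have hu' : u = 0 := by simpa using hu
    have hv' : v = 0 := by simpa using hv
    rw [hu', hv', sub_self]
  · rw [Set.image_empty, Submodule.span_empty, finrank_bot]

theorem IsGradedToric.sup {V W : Set σ} {J J' : Ideal (MvPolynomial σ K)} {d d' : ℕ} {p : Prop}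
    (h : IsGradedToric V J d p) (h' : IsGradedToric W J' d' p) (hVW : (V ∩ W).Subsingleton) :
    ∃ e, e + (V ∩ W).ncard = d + d' ∧ IsGradedToric (V ∪ W) (J ⊔ J') e p := by
  obtain ⟨M, _, _, _, α, l, hl, rfl, rfl, hα⟩ := h
  obtain ⟨N, _, _, _, β, l', hl', rfl, rfl, hβ⟩ := h'
  exact ⟨_, finrank_span_glue l hl hVW, _, inferInstance, inferInstance, inferInstance,
    glue α β V W, glueDegree l l' hl hl', glueDegree_glue l l' hl hl',
    (binomialIdeal_glue K l hl hVW).symm, rfl,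
    fun hp => glue_injOn l l' hl hl' hVW (hα hp) (hβ hp)⟩

/-- Were the degrees different, a homogeneous component of the binomial would be a single monomial,
whose image is never zero. -/
theorem degree_eq_of_isHomogeneousIdeal {M : Type*} [AddCommMonoid M] {α : σ → M}
    (h : IsHomogeneousIdeal (RingHom.ker (groupAlgebraMap K α))) {u v : σ →₀ ℕ}
    (huv : Finsupp.linearCombination ℕ α u = Finsupp.linearCombination ℕ α v) :
    u.degree = v.degree := by
  by_contra hne
  let _ : GradedAlgebra (homogeneousSubmodule σ K) := gradedAlgebra
  have hu : monomial u (1 : K) ∈ homogeneousSubmodule σ K u.degree :=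
    isHomogeneous_monomial _ rfl
  have hv : monomial v (1 : K) ∈ homogeneousSubmodule σ K v.degree :=
    isHomogeneous_monomial _ rfl
  have := h u.degree ((binomial_mem_ker_iff (K := K) α u v).2 huv)
  rw [DirectSum.decompose_sub, DirectSum.sub_apply, AddSubgroupClass.coe_sub,
    DirectSum.decompose_of_mem_same _ hu, DirectSum.decompose_of_mem_ne _ hv (Ne.symm hne),
    sub_zero, RingHom.mem_ker, groupAlgebraMap_monomial] at this
  simp at this

/-- The minimal parametrization may differ from `α`, but a coincidence `α i = α j` is the binomial
`x_i - x_j` of the ideal, hence holds in every parametrization. -/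
theorem injective_of_isMinimallyParametrizedToric {M : Type*} [AddCommMonoid M] {α : σ → M}
    (h : IsMinimallyParametrizedToric (RingHom.ker (groupAlgebraMap K α))) :
    Function.Injective α := by
  intro i j hij
  by_contra hne
  obtain ⟨m, β, hβ, hker⟩ := h
  have h1 : monomial (Finsupp.single i 1) (1 : K) - monomial (Finsupp.single j 1) 1 ∈
      RingHom.ker (groupAlgebraMap K α) := (binomial_mem_ker_iff α _ _).2 (by simpa using hij)
  rw [← hker, monomialMap_eq_groupAlgebraMap, binomial_mem_ker_iff] at h1
  refine hβ i (Algebra.subset_adjoin ⟨j, Ne.symm hne, ?_⟩)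
  have : β i = β j := by simpa using h1
  simp only [this]

/-- The rational vector with the coordinates of an integral vector. -/
def ratCast {m : ℕ} : (Fin m → ℤ) →+ (Fin m → ℚ) := (Int.castAddHom ℚ).compLeft (Fin m)

theorem ratCast_injective {m : ℕ} : Function.Injective (ratCast (m := m)) := fun _ _ h =>
  funext fun i => Int.cast_injective (congrFun h i)

theorem IsToric.isGradedToric_map_rename [Finite τ] {I : Ideal (MvPolynomial τ K)} (hI : IsToric I)
    (hhom : IsHomogeneousIdeal I) {f : τ → σ} (hf : Function.Injective f) :
    ∃ d : ℕ, ringKrullDim (MvPolynomial τ K ⧸ I) = (d : WithBot ℕ∞) ∧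
      IsGradedToric (Set.range f)
        (I.map (rename f : MvPolynomial τ K →ₐ[K] MvPolynomial σ K)) d
        (IsMinimallyParametrizedToric I) := by
  obtain ⟨m, a, rfl⟩ := hI
  rw [monomialMap_eq_groupAlgebraMap] at hhom ⊢
  -- The extra coordinate 1 records the degree; by homogeneity it imposes no new condition on
  -- relations.
  let α : τ → (Fin m → ℚ) × ℚ := fun c => (ratCast (a c), 1)
  let β : σ → (Fin m → ℚ) × ℚ := Function.extend f α 0
  have hβ : β ∘ f = α := Function.extend_comp hf α 0
  have hl : ∀ c ∈ Set.univ, LinearMap.snd ℚ (Fin m → ℚ) ℚ (α c) = 1 := fun c _ => rfl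
  have hker : RingHom.ker (groupAlgebraMap K a) = binomialIdeal K Set.univ α := by
    rw [ker_groupAlgebraMap]
    refine binomialIdeal_congr fun u v _ _ => ?_
    have h1 : ∀ u : τ →₀ ℕ, (Finsupp.linearCombination ℕ α u).1 =
        ratCast (Finsupp.linearCombination ℕ a u) := fun u =>
      (map_linearCombination_nat (LinearMap.fst ℚ (Fin m → ℚ) ℚ) α u).trans
        (map_linearCombination_nat ratCast a u).symm
    have h2 : ∀ u : τ →₀ ℕ, (Finsupp.linearCombination ℕ α u).2 = u.degree := fun u =>
      apply_linearCombination_eq_degree hl (Set.subset_univ _)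
    rw [Prod.ext_iff, h1, h1, h2, h2, ratCast_injective.eq_iff, Nat.cast_inj]
    exact ⟨fun h => ⟨h, degree_eq_of_isHomogeneousIdeal hhom h⟩, And.left⟩
  refine ⟨_, ?_, (Fin m → ℚ) × ℚ, inferInstance, inferInstance, inferInstance, β,
    LinearMap.snd _ _ _, ?_, ?_, rfl, ?_⟩
  · rw [hker, ← ker_groupAlgebraMap, ringKrullDim_quotient_ker_groupAlgebraMap, ← Set.range_comp,
      hβ]
  · rintro _ ⟨c, rfl⟩
    exact congrArg Prod.snd (congrFun hβ c)
  · rw [hker, ← hβ, map_rename_binomialIdeal_univ hf]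
  · rintro hmin _ ⟨c, rfl⟩ _ ⟨c', rfl⟩ h
    have h' : α c = α c' := by rw [← hβ]; exact h
    rw [injective_of_isMinimallyParametrizedToric hmin
      (ratCast_injective (congrArg Prod.fst h'))]

/-- Finitely many vectors have finitely many coordinates, so one common denominator clears them all;
scaling by it is injective. -/
theorem exists_integral_configuration [Finite σ] {M : Type*} [AddCommGroup M] [Module ℚ M]
    [Module.Finite ℚ M] (α : σ → M) :
    ∃ (m : ℕ) (a : σ → Fin m → ℤ), ∀ u v : σ →₀ ℕ,
      Finsupp.linearCombination ℕ a u = Finsupp.linearCombination ℕ a v ↔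
        Finsupp.linearCombination ℕ α u = Finsupp.linearCombination ℕ α v := by
  let b := Module.finBasis ℚ M
  obtain ⟨N, hN⟩ := IsLocalization.exist_integer_multiples_of_finite (nonZeroDivisors ℤ)
    (fun x : σ × Fin (Module.finrank ℚ M) => b.equivFun (α x.1) x.2)
  choose a ha using hN
  have hN0 : (N : ℤ) ≠ 0 := nonZeroDivisors.ne_zero N.2
  refine ⟨_, fun c i => a (c, i), fun u v => ?_⟩
  let L : M →+ (Fin (Module.finrank ℚ M) → ℚ) :=
    ((N : ℤ) • (b.equivFun : M →ₗ[ℚ] Fin (Module.finrank ℚ M) → ℚ).toAddMonoidHom)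
  have hL : Function.Injective L := fun x y h =>
    b.equivFun.injective (smul_right_injective _ hN0 h)
  have key : ∀ u : σ →₀ ℕ, ratCast (Finsupp.linearCombination ℕ (fun c i => a (c, i)) u) =
      L (Finsupp.linearCombination ℕ α u) := by
    intro u
    rw [map_linearCombination_nat, map_linearCombination_nat]
    congr 2
    ext c i
    exact ha (c, i)
  rw [← ratCast_injective.eq_iff, key, key, hL.eq_iff]

theorem IsGradedToric.isHomogeneousIdeal {V : Set σ} {J : Ideal (MvPolynomial σ K)} {d : ℕ}
    {p : Prop} (h : IsGradedToric V J d p) : IsHomogeneousIdeal J := by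
  obtain ⟨M, _, _, _, α, l, hl, rfl, rfl, -⟩ := h
  let _ : GradedAlgebra (homogeneousSubmodule σ K) := gradedAlgebra
  refine Ideal.homogeneous_span _ _ ?_
  rintro f ⟨u, v, hu, hv, h, rfl⟩
  have : u.degree = v.degree := by
    have := congrArg l h
    rw [apply_linearCombination_eq_degree hl hu, apply_linearCombination_eq_degree hl hv] at this
    exact_mod_cast this
  exact ⟨u.degree, sub_mem (isHomogeneous_monomial _ rfl) (isHomogeneous_monomial _ this.symm)⟩

/-- A monomial in the algebra generated by the others has its exponent in the monoid they generate.
The degree functional leaves room for only one summand, so two vectors would coincide. -/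
theorem notMem_adjoin_of_injective {M : Type*} [AddCommGroup M] [Module ℚ M] {α : σ → M}
    {l : M →ₗ[ℚ] ℚ} (hl : ∀ c ∈ Set.univ, l (α c) = 1) (hα : Function.Injective α) {m : ℕ}
    {a : σ → Fin m → ℤ} (ha : ∀ u v : σ →₀ ℕ,
      Finsupp.linearCombination ℕ a u = Finsupp.linearCombination ℕ a v →
        Finsupp.linearCombination ℕ α u = Finsupp.linearCombination ℕ α v) (i : σ) :
    laurentMonomial K (a i) ∉
      Algebra.adjoin K ((fun j => laurentMonomial K (a j)) '' {j | j ≠ i}) := by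
  intro h
  rw [← Subalgebra.mem_toSubmodule, Algebra.adjoin_eq_span] at h
  have hcl : a i ∈ AddSubmonoid.closure (a '' {j | j ≠ i}) := by
    refine AddMonoidAlgebra.mem_closure_of_mem_span_closure (R := K) ?_
    rw [← Set.image_comp]
    exact h
  rw [← Submodule.span_nat_eq_addSubmonoidClosure, Submodule.mem_toAddSubmonoid,
    Finsupp.mem_span_image_iff_linearCombination] at hcl
  obtain ⟨u, hu, h⟩ := hcl
  have h' : Finsupp.linearCombination ℕ α u = Finsupp.linearCombination ℕ α (.single i 1) :=
    ha _ _ (by simpa using h)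
  have hdeg : u.degree = 1 := by
    have := congrArg l h'
    rw [apply_linearCombination_eq_degree hl (Set.subset_univ _),
      apply_linearCombination_eq_degree hl (Set.subset_univ _)] at this
    simpa using this
  obtain ⟨j, rfl⟩ : u ∈ Set.range fun j : σ => Finsupp.single j 1 :=
    Finsupp.range_single_one.ge hdeg
  have hj : j ≠ i := hu (by simp)
  exact hj (hα (by simpa using h'))

theorem IsGradedToric.isToric [Finite σ] {J : Ideal (MvPolynomial σ K)} {d : ℕ}
    {p : Prop} (h : IsGradedToric Set.univ J d p) :
    IsToric J ∧ (p → IsMinimallyParametrizedToric J) := by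
  obtain ⟨M, _, _, _, α, l, hl, rfl, rfl, hp⟩ := h
  obtain ⟨m, a, ha⟩ := exists_integral_configuration α
  have hker : RingHom.ker (monomialMap K a) = binomialIdeal K Set.univ α := by
    rw [monomialMap_eq_groupAlgebraMap, ker_groupAlgebraMap]
    exact binomialIdeal_congr fun u v _ _ => ha u v
  exact ⟨⟨m, a, hker⟩, fun h => ⟨m, a, notMem_adjoin_of_injective hl
    (Set.injOn_univ.1 (hp h)) fun u v => (ha u v).1, hker⟩⟩

theorem IsGradedToric.ringKrullDim_quotient [Finite σ] {J : Ideal (MvPolynomial σ K)} {d : ℕ}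
    {p : Prop} (h : IsGradedToric Set.univ J d p) :
    ringKrullDim (MvPolynomial σ K ⧸ J) = (d : WithBot ℕ∞) := by
  obtain ⟨M, _, _, _, α, l, hl, rfl, rfl, hp⟩ := h
  rw [← ker_groupAlgebraMap, ringKrullDim_quotient_ker_groupAlgebraMap, Set.image_univ]

end GradedToric

/-! ### Induction over the forest. -/

section Forest

variable {K : Type*} [Field K] {ι σ : Type*}

open scoped Classical in
-- Each edge from `i` to `T` counts once at either end.
theorem sum_card_filter_adj_insert (G : SimpleGraph ι) {T : Finset ι} {i : ι} (hi : i ∉ T) :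
    ∑ a ∈ insert i T, ((insert i T).filter (G.Adj a)).card =
      ∑ a ∈ T, (T.filter (G.Adj a)).card + 2 * (T.filter (G.Adj i)).card := by
  have h1 : (insert i T).filter (G.Adj i) = T.filter (G.Adj i) := by
    rw [Finset.filter_insert, if_neg (G.loopless.irrefl i)]
  have h2 : ∀ a ∈ T, ((insert i T).filter (G.Adj a)).card =
      (T.filter (G.Adj a)).card + if G.Adj i a then 1 else 0 := by
    intro a _
    rw [Finset.filter_insert]
    by_cases h : G.Adj i a
    · rw [if_pos h.symm, if_pos h, Finset.card_insert_of_notMem (by simp [hi])]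
    · rw [if_neg fun h' => h h'.symm, if_neg h, add_zero]
  rw [Finset.sum_insert hi, h1, Finset.sum_congr rfl h2, Finset.sum_add_distrib,
    ← Finset.card_filter]
  ring

open scoped Classical in
-- A vertex with at most one neighbour in `S` is glued on last, so its overlap with the rest is at
-- most one variable. The degree sum is twice the number of edges, each of which costs one
-- dimension.
theorem exists_isGradedToric_sum {G : SimpleGraph ι} (hG : G.IsAcyclic) {V : ι → Set σ}
    (hadj : ∀ i j, i ≠ j → (G.Adj i j ↔ (V i ∩ V j).Nonempty))
    (hV : ∀ i j, i ≠ j → (V i ∩ V j).Subsingleton) {J : ι → Ideal (MvPolynomial σ K)} {d : ι → ℕ}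
    {p : Prop} (hJ : ∀ i, IsGradedToric (V i) (J i) (d i) p) (S : Finset ι) :
    ∃ e, 2 * e + ∑ a ∈ S, (S.filter (G.Adj a)).card = 2 * ∑ i ∈ S, d i ∧
      IsGradedToric (⋃ i ∈ S, V i) (∑ i ∈ S, J i) e p := by
  induction S using Finset.strongInduction with
  | H S ih =>
    rcases S.eq_empty_or_nonempty with rfl | hS
    · exact ⟨0, by simp, by simpa using isGradedToric_bot p⟩
    obtain ⟨i, hiS, hdeg⟩ := exists_card_filter_adj_le_one G hG hS
    obtain ⟨T, hi, rfl⟩ : ∃ T, i ∉ T ∧ insert i T = S :=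
      ⟨S.erase i, Finset.notMem_erase i S, Finset.insert_erase hiS⟩
    obtain ⟨e, he, hT⟩ := ih T (Finset.ssubset_insert hi)
    rw [Finset.filter_insert, if_neg (G.loopless.irrefl i)] at hdeg
    have hne : ∀ j ∈ T, i ≠ j := fun j hj h => hi (h ▸ hj)
    have hinter : (V i ∩ ⋃ j ∈ T, V j).Subsingleton ∧
        (V i ∩ ⋃ j ∈ T, V j).ncard = (T.filter (G.Adj i)).card := by
      -- Only the neighbours of `i` contribute to the overlap.
      have hsub : V i ∩ ⋃ j ∈ T, V j = ⋃ j ∈ T.filter (G.Adj i), V i ∩ V j := by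
        ext c
        simp only [Set.mem_inter_iff, Set.mem_iUnion, Finset.mem_filter, exists_prop]
        constructor
        · rintro ⟨hc, j, hj, hcj⟩
          exact ⟨j, ⟨hj, (hadj i j (hne j hj)).2 ⟨c, hc, hcj⟩⟩, hc, hcj⟩
        · rintro ⟨j, ⟨hj, -⟩, hc, hcj⟩
          exact ⟨hc, j, hj, hcj⟩
      rw [hsub]
      rcases Nat.le_one_iff_eq_zero_or_eq_one.1 hdeg with h | h
      · rw [h, Finset.card_eq_zero.1 h]
        simp
      · obtain ⟨j, hj⟩ := Finset.card_eq_one.1 h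
        have hjT : j ∈ T.filter (G.Adj i) := hj ▸ Finset.mem_singleton_self j
        rw [Finset.mem_filter] at hjT
        have hsing := hV i j (hne j hjT.1)
        rw [h, hj]
        simp only [Finset.mem_singleton, Set.iUnion_iUnion_eq_left]
        refine ⟨hsing, ?_⟩
        obtain ⟨c, hc⟩ := ((hadj i j (hne j hjT.1)).1 hjT.2).exists_eq_singleton_or_nontrivial
          |>.resolve_right hsing.not_nontrivial
        rw [hc, Set.ncard_singleton]
    obtain ⟨e', he', h'⟩ := (hJ i).sup hT hinter.1
    refine ⟨e', ?_, ?_⟩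
    · rw [sum_card_filter_adj_insert G hi, Finset.sum_insert hi]
      rw [hinter.2] at he'
      omega
    · rw [Finset.sum_insert hi, Finset.set_biUnion_insert]
      exact h'

end Forest

end ToricSum

/-! ### The main theorem. -/

theorem mainTheorem2 {K : Type*} [Field K] {σ : Type*} [DecidableEq σ] (k : ℕ)
    (X : Fin k → Finset σ) (I : ∀ i, Ideal (MvPolynomial (X i) K))
    (hToric : ∀ i, ToricSum.IsToric (I i))
    (hHom : ∀ i, ToricSum.IsHomogeneousIdeal (I i))
    (hShare : ∀ i j, i ≠ j → (X i ∩ X j).card ≤ 1)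
    (hTree : ∀ c : (ToricSum.varGraph X).ConnectedComponent, c.toSimpleGraph.IsTree) :
    ToricSum.IsToric (ToricSum.idealSum X I) ∧
    ToricSum.IsHomogeneousIdeal (ToricSum.idealSum X I) ∧
    ((∀ i, ToricSum.IsMinimallyParametrizedToric (I i)) →
      ToricSum.IsMinimallyParametrizedToric (ToricSum.idealSum X I)) ∧
    ringKrullDim (MvPolynomial (ToricSum.allVars X) K ⧸ ToricSum.idealSum X I) + (k : WithBot ℕ∞) =
      ∑ i, ringKrullDim (MvPolynomial (X i) K ⧸ I i) +
        (Nat.card (ToricSum.varGraph X).ConnectedComponent : WithBot ℕ∞) := by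
  classical
  have hfin : Finite (ToricSum.allVars X) := by
    have : ToricSum.allVars X = ⋃ i, (X i : Set σ) := by
      ext x
      simp [ToricSum.allVars]
    rw [this]
    infer_instance
  let f : ∀ i, X i → ToricSum.allVars X := fun i x => ⟨x.1, i, x.2⟩
  have hf : ∀ i, Function.Injective (f i) := fun i x y h =>
    Subtype.ext (congrArg (fun c : ToricSum.allVars X => c.1) h)
  have hrange : ∀ i c, c ∈ Set.range (f i) ↔ c.1 ∈ X i := fun i c =>
    ⟨by rintro ⟨x, rfl⟩; exact x.2, fun h => ⟨⟨c.1, h⟩, rfl⟩⟩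
  choose d hd hgr using fun i => (hToric i).isGradedToric_map_rename (hHom i) (hf i)
  -- Gluing needs the same proposition `p` on both sides, so it becomes minimality of all the ideals
  -- at once.
  have hgr' : ∀ i, ToricSum.IsGradedToric (Set.range (f i)) ((I i).map (ToricSum.inclHom K X i))
      (d i) (∀ i, ToricSum.IsMinimallyParametrizedToric (I i)) := by
    intro i
    obtain ⟨M, h1, h2, h3, α, l, hl, hJ, hd, hp⟩ := hgr i
    exact ⟨M, h1, h2, h3, α, l, hl, hJ, hd, fun h => hp (h i)⟩
  obtain ⟨e, he, hsum⟩ := ToricSum.exists_isGradedToric_sum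
    (ToricSum.isAcyclic_of_forall_isTree _ hTree)
    (fun i j hij => by
      constructor
      · rintro ⟨-, x, hx, hx'⟩
        exact ⟨⟨x, i, hx⟩, (hrange i _).2 hx, (hrange j _).2 hx'⟩
      · rintro ⟨c, hc, hc'⟩
        exact ⟨hij, c.1, (hrange i c).1 hc, (hrange j c).1 hc'⟩)
    (fun i j hij c hc c' hc' => Subtype.ext <| Finset.card_le_one.1 (hShare i j hij) _
      (Finset.mem_inter.2 ⟨(hrange i c).1 hc.1, (hrange j c).1 hc.2⟩) _
      (Finset.mem_inter.2 ⟨(hrange i c').1 hc'.1, (hrange j c').1 hc'.2⟩))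
    hgr' Finset.univ
  have huniv : ⋃ i ∈ (Finset.univ : Finset (Fin k)), Set.range (f i) = Set.univ := by
    refine Set.eq_univ_of_forall fun c => ?_
    obtain ⟨i, hi⟩ := c.2
    exact Set.mem_iUnion₂.2 ⟨i, Finset.mem_univ i, (hrange i c).2 hi⟩
  rw [huniv] at hsum
  refine ⟨hsum.isToric.1, hsum.isHomogeneousIdeal, hsum.isToric.2, ?_⟩
  have hcount := ToricSum.sum_degree_add_card_connectedComponent _ hTree
  have hdeg : ∑ v, (ToricSum.varGraph X).degree v =
      ∑ a, (Finset.univ.filter ((ToricSum.varGraph X).Adj a)).card :=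
    Finset.sum_congr rfl fun v _ => by
      rw [← SimpleGraph.card_neighborFinset_eq_degree, SimpleGraph.neighborFinset_eq_filter]
  rw [hdeg, Fintype.card_fin] at hcount
  -- Eliminates the degree sum between the induction formula and the handshake lemma.
  have hnat : e + k = ∑ i, d i + Nat.card (ToricSum.varGraph X).ConnectedComponent := by omega
  rw [show ToricSum.idealSum X I = ∑ i, (I i).map (ToricSum.inclHom K X i) from rfl,
    hsum.ringKrullDim_quotient, Finset.sum_congr rfl fun i _ => hd i]
  exact_mod_cast congrArg (Nat.cast : ℕ → WithBot ℕ∞) hnat
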